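/- Let $\alpha_1,\alpha_2\in\mathbb{C}$ with $|\alpha_1|=|\alpha_2|=1$, neither of which is a non-negative real number, and suppose $\alpha_1\neq\alpha_2$ and $\alpha_2\neq\overline{\alpha_1}$. Let $c_1,c_2$ be nonzero complex numbers and put $$b(n) := c_1\alpha_1^n+\overline{c_1}\,\overline{\alpha_1}^{\,n}+c_2\alpha_2^n+\overline{c_2}\,\overline{\alpha_2}^{\,n},\qquad n\ge 0,$$ which is a sequence of real numbers. Then there is $\delta>0$ such that $b(n)>\delta$ for infinitely many $n$ and $b(n)<-\delta$ for infinitely many $n$. -/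

import Mathlib

open scoped ComplexConjugate

/-- The sequence `b(n) = c₁ α₁ⁿ + c̄₁ ᾱ₁ⁿ + c₂ α₂ⁿ + c̄₂ ᾱ₂ⁿ`, as a sequence of complex numbers. -/
noncomputable def bSeq (α₁ α₂ c₁ c₂ : ℂ) (n : ℕ) : ℂ :=
  c₁ * α₁ ^ n + conj c₁ * conj α₁ ^ n + c₂ * α₂ ^ n + conj c₂ * conj α₂ ^ n

/-!
Write `b n = Re (2 c₁ α₁ⁿ + 2 c₂ α₂ⁿ)`. The powers of an element of a compact group accumulate at
each of themselves; applied to `(α₁, α₂)` in the torus, this shows that `b` accumulates at each of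
its values, so a single positive value of `b` yields infinitely many values above a positive bound.
Since `α₁, α₂ ≠ 1`, the partial sums of `b` are bounded. If `b` were nonpositive, it would then be
summable and tend to `0`, hence vanish identically by recurrence; likewise if it were nonnegative.

It remains to see that `b` is not identically zero. At least one of the two frequencies, say `α₂`,
is not real. The sequence `Re (cᵢ αᵢⁿ)` solves `x (n + 2) = 2 Re αᵢ * x (n + 1) - x n`, and since
`Re α₁ ≠ Re α₂`, only the zero sequence solves both recurrences, so the two terms cannot cancel.
-/

open Filter Finset

section Recurrence

variable {X Y : Type*} [TopologicalSpace X] [TopologicalSpace Y]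

/-- A sequence is recurrent if each of its values is one of its cluster points. This is the part of
almost periodicity that passes from a compact group to its continuous images. -/
def IsRecurrent (u : ℕ → X) : Prop :=
  ∀ m, MapClusterPt (u m) atTop u

theorem isRecurrent_pow {G : Type*} [Group G] [TopologicalSpace G] [CompactSpace G]
    [IsTopologicalGroup G] (x : G) : IsRecurrent fun n : ℕ ↦ x ^ n :=
  fun m ↦ by simpa using mapClusterPt_self_zpow_atTop_pow x m

namespace IsRecurrent

theorem continuous_comp {f : X → Y} {u : ℕ → X} (hf : Continuous f) (hu : IsRecurrent u) :
    IsRecurrent (f ∘ u) :=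
  fun m ↦ (hu m).tendsto_comp (hf.tendsto (u m))

theorem eq_of_tendsto [T2Space X] {u : ℕ → X} {x : X} (hu : IsRecurrent u)
    (hx : Tendsto u atTop (nhds x)) (m : ℕ) : u m = x :=
  eq_of_nhds_neBot (ClusterPt.mono (hu m) hx).neBot

theorem frequently_lt [LinearOrder X] [ClosedIicTopology X] {u : ℕ → X} {a : X} {m : ℕ}
    (hu : IsRecurrent u) (ha : a < u m) : ∃ᶠ n in atTop, a < u n :=
  (hu m).frequently (eventually_gt_nhds ha)

theorem frequently_gt [LinearOrder X] [ClosedIciTopology X] {u : ℕ → X} {a : X} {m : ℕ}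
    (hu : IsRecurrent u) (ha : u m < a) : ∃ᶠ n in atTop, u n < a :=
  (hu m).frequently (eventually_lt_nhds ha)

theorem exists_pos_of_le_sum_range {b : ℕ → ℝ} {C : ℝ} (hb : IsRecurrent b)
    (hC : ∀ n, C ≤ ∑ i ∈ range n, b i) (hne : ∃ n, b n ≠ 0) : ∃ n, 0 < b n := by
  by_contra! hnonpos
  have hsummable : Summable fun n ↦ -b n :=
    summable_of_sum_range_le (fun n ↦ neg_nonneg.2 (hnonpos n)) (c := -C) fun n ↦ by
      rw [sum_neg_distrib]
      exact neg_le_neg (hC n)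
  obtain ⟨m, hm⟩ := hne
  exact hm (hb.eq_of_tendsto hsummable.of_neg.tendsto_atTop_zero m)

theorem exists_frequently_lt_and_lt_neg {b : ℕ → ℝ} {C : ℝ} (hb : IsRecurrent b)
    (hC : ∀ n, |∑ i ∈ range n, b i| ≤ C) (hne : ∃ n, b n ≠ 0) :
    ∃ δ > 0, (∃ᶠ n in atTop, δ < b n) ∧ ∃ᶠ n in atTop, b n < -δ := by
  obtain ⟨p, hp⟩ := hb.exists_pos_of_le_sum_range (fun n ↦ (abs_le.1 (hC n)).1) hne
  obtain ⟨q, hq⟩ : ∃ q, 0 < -b q :=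
    (hb.continuous_comp continuous_neg).exists_pos_of_le_sum_range (C := -C)
      (fun n ↦ by simpa using (abs_le.1 (hC n)).2) (by simpa using hne)
  obtain ⟨δ, hδ, hδ_lt⟩ := exists_between (lt_min hp hq)
  obtain ⟨hδp, hδq⟩ := lt_min_iff.1 hδ_lt
  exact ⟨δ, hδ, hb.frequently_lt hδp, hb.frequently_gt (lt_neg.1 hδq)⟩

end IsRecurrent

end Recurrence

section ExponentialSums

theorem norm_geom_sum_le_of_norm_le_one {K : Type*} [NormedDivisionRing K] {x : K}
    (hx : ‖x‖ ≤ 1) (hx1 : x ≠ 1) (n : ℕ) : ‖∑ i ∈ range n, x ^ i‖ ≤ 2 / ‖x - 1‖ := by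
  rw [geom_sum_eq hx1, norm_div]
  gcongr
  calc ‖x ^ n - 1‖ ≤ ‖x ^ n‖ + ‖(1 : K)‖ := norm_sub_le _ _
    _ ≤ 1 + 1 := by
      rw [norm_pow, norm_one]
      gcongr
      exact pow_le_one₀ (norm_nonneg x) hx
    _ = 2 := one_add_one_eq_two

variable {ι : Type*} [Fintype ι] {α : ι → ℂ}

theorem isRecurrent_re_sum_mul_pow (hα : ∀ i, ‖α i‖ = 1) (c : ι → ℂ) :
    IsRecurrent fun n : ℕ ↦ (∑ i, c i * α i ^ n).re := by
  let z : ι → Circle := fun i ↦ ⟨α i, mem_sphere_zero_iff_norm.2 (hα i)⟩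
  let f : (ι → Circle) → ℝ := fun w ↦ (∑ i, c i * (w i : ℂ)).re
  have hf : Continuous f := by fun_prop
  exact (isRecurrent_pow z).continuous_comp (f := f) hf

theorem abs_sum_range_re_sum_mul_pow_le (hα : ∀ i, ‖α i‖ ≤ 1) (hα1 : ∀ i, α i ≠ 1) (c : ι → ℂ)
    (n : ℕ) :
    |∑ k ∈ range n, (∑ i, c i * α i ^ k).re| ≤ ∑ i, ‖c i‖ * (2 / ‖α i - 1‖) :=
  calc |∑ k ∈ range n, (∑ i, c i * α i ^ k).re|
      = |(∑ i, c i * ∑ k ∈ range n, α i ^ k).re| := by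
        simp only [← Complex.re_sum, sum_comm (s := range n), mul_sum]
    _ ≤ ‖∑ i, c i * ∑ k ∈ range n, α i ^ k‖ := Complex.abs_re_le_norm _
    _ ≤ ∑ i, ‖c i‖ * (2 / ‖α i - 1‖) := norm_sum_le_of_le _ fun i _ ↦ by
        rw [norm_mul]
        gcongr
        exact norm_geom_sum_le_of_norm_le_one (hα i) (hα1 i) n

theorem exists_frequently_lt_re_sum_mul_pow_and_lt_neg {c : ι → ℂ} (hα : ∀ i, ‖α i‖ = 1)
    (hα1 : ∀ i, α i ≠ 1) (hne : ∃ n : ℕ, (∑ i, c i * α i ^ n).re ≠ 0) :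
    ∃ δ > 0, (∃ᶠ n : ℕ in atTop, δ < (∑ i, c i * α i ^ n).re) ∧
      ∃ᶠ n : ℕ in atTop, (∑ i, c i * α i ^ n).re < -δ :=
  (isRecurrent_re_sum_mul_pow hα c).exists_frequently_lt_and_lt_neg
    (abs_sum_range_re_sum_mul_pow_le (fun i ↦ (hα i).le) hα1 c) hne

end ExponentialSums

section NonVanishing

theorem eq_or_eq_conj_of_norm_eq_of_re_eq {z w : ℂ} (hnorm : ‖z‖ = ‖w‖) (hre : z.re = w.re) :
    z = w ∨ z = conj w := by
  have him : z.im ^ 2 = w.im ^ 2 := by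
    rw [← Complex.sq_norm_sub_sq_re, ← Complex.sq_norm_sub_sq_re, hnorm, hre]
  exact (sq_eq_sq_iff_eq_or_eq_neg.1 him).imp (Complex.ext hre) (Complex.ext hre)

theorem eq_neg_one_of_norm_eq_one_of_im_eq_zero {z : ℂ} (hz : ‖z‖ = 1) (him : z.im = 0)
    (hz1 : z ≠ 1) : z = -1 := by
  obtain ⟨x, rfl⟩ : ∃ x : ℝ, (x : ℂ) = z := ⟨z.re, Complex.ext rfl him.symm⟩
  rw [Complex.norm_real] at hz
  obtain rfl | rfl := eq_or_eq_neg_of_abs_eq hz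
  · exact absurd Complex.ofReal_one hz1
  · simp

theorem re_mul_pow_add_two (c z : ℂ) (n : ℕ) :
    (c * z ^ (n + 2)).re = 2 * z.re * (c * z ^ (n + 1)).re - ‖z‖ ^ 2 * (c * z ^ n).re := by
  rw [Complex.sq_norm, Complex.normSq_apply, pow_succ _ (n + 1), pow_succ _ n, ← mul_assoc,
    ← mul_assoc]
  simp only [Complex.mul_re, Complex.mul_im]
  ring

theorem exists_re_mul_pow_ne_zero {c z : ℂ} (hc : c ≠ 0) (hz : z.im ≠ 0) :
    ∃ n : ℕ, (c * z ^ n).re ≠ 0 := by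
  by_contra! hzero
  have hre : c.re = 0 := by simpa using hzero 0
  have him : c.im * z.im = 0 := by simpa [hre] using hzero 1
  exact hc (Complex.ext hre ((mul_eq_zero.1 him).resolve_right hz))

theorem exists_re_add_ne_zero_of_im_ne_zero {α β c d : ℂ} (hnorm : ‖α‖ = ‖β‖) (hne : α ≠ β)
    (hconj : α ≠ conj β) (him : β.im ≠ 0) (hd : d ≠ 0) :
    ∃ n : ℕ, (c * α ^ n + d * β ^ n).re ≠ 0 := by
  by_contra! hzero
  have hre : α.re - β.re ≠ 0 := fun h ↦
    (eq_or_eq_conj_of_norm_eq_of_re_eq hnorm (sub_eq_zero.1 h)).elim hne hconj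
  have hβ : ‖β‖ ^ 2 ≠ 0 := by
    have : β ≠ 0 := by rintro rfl; exact him rfl
    positivity
  have hα_eq : ∀ n : ℕ, (c * α ^ n).re = -(d * β ^ n).re := fun n ↦
    eq_neg_of_add_eq_zero_left (hzero n)
  -- Both terms satisfy both recurrences, whose difference is a multiple of the middle term.
  have hsucc : ∀ n : ℕ, (d * β ^ (n + 1)).re = 0 := fun n ↦ by
    have hrec := re_mul_pow_add_two c α n
    rw [hα_eq, hα_eq, hα_eq, hnorm, re_mul_pow_add_two d β n] at hrec
    refine (mul_eq_zero.1 ?_).resolve_left hre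
    linarith
  obtain ⟨n, hn⟩ := exists_re_mul_pow_ne_zero hd him
  have hrec := re_mul_pow_add_two d β n
  rw [hsucc n, hsucc (n + 1), mul_zero, zero_sub, zero_eq_neg] at hrec
  exact mul_ne_zero hβ hn hrec

theorem exists_re_add_ne_zero {α β c d : ℂ} (hα : ‖α‖ = 1) (hβ : ‖β‖ = 1) (hα1 : α ≠ 1)
    (hβ1 : β ≠ 1) (hne : α ≠ β) (hconj : β ≠ conj α) (hc : c ≠ 0) (hd : d ≠ 0) :
    ∃ n : ℕ, (c * α ^ n + d * β ^ n).re ≠ 0 := by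
  by_cases hα_im : α.im = 0
  · by_cases hβ_im : β.im = 0
    · exact absurd ((eq_neg_one_of_norm_eq_one_of_im_eq_zero hα hα_im hα1).trans
        (eq_neg_one_of_norm_eq_one_of_im_eq_zero hβ hβ_im hβ1).symm) hne
    · refine exists_re_add_ne_zero_of_im_ne_zero (hα.trans hβ.symm) hne ?_ hβ_im hd
      rintro rfl
      exact hconj (Complex.conj_conj β).symm
  · simp only [add_comm (c * _)]
    exact exists_re_add_ne_zero_of_im_ne_zero (hβ.trans hα.symm) hne.symm hconj hα_im hc

end NonVanishing

theorem bSeq_eq_ofReal (α₁ α₂ c₁ c₂ : ℂ) (n : ℕ) :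
    bSeq α₁ α₂ c₁ c₂ n = ((2 * c₁ * α₁ ^ n + 2 * c₂ * α₂ ^ n).re : ℝ) := by
  rw [Complex.re_eq_add_conj, bSeq]
  simp only [map_add, map_mul, map_pow, map_ofNat]
  ring

/-- The first conjunct says that `b(n)` is real, so that its real part is `b(n)` itself. -/
theorem mainTheorem2 (α₁ α₂ c₁ c₂ : ℂ)
    (hα₁ : ∀ r : ℝ, 0 ≤ r → α₁ ≠ (r : ℂ)) (hα₂ : ∀ r : ℝ, 0 ≤ r → α₂ ≠ (r : ℂ))
    (hn₁ : ‖α₁‖ = 1) (hn₂ : ‖α₂‖ = 1)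
    (h₁₂ : α₁ ≠ α₂) (h₂₁ : α₂ ≠ conj α₁)
    (hc₁ : c₁ ≠ 0) (hc₂ : c₂ ≠ 0) :
    (∀ n : ℕ, (bSeq α₁ α₂ c₁ c₂ n).im = 0) ∧
      ∃ δ : ℝ, 0 < δ ∧
        {n : ℕ | δ < (bSeq α₁ α₂ c₁ c₂ n).re}.Infinite ∧
        {n : ℕ | (bSeq α₁ α₂ c₁ c₂ n).re < -δ}.Infinite := by
  refine ⟨fun n ↦ by rw [bSeq_eq_ofReal, Complex.ofReal_im], ?_⟩
  simp only [bSeq_eq_ofReal, Complex.ofReal_re, ← Nat.frequently_atTop_iff_infinite]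
  have hα₁_ne_one : α₁ ≠ 1 := by simpa using hα₁ 1 zero_le_one
  have hα₂_ne_one : α₂ ≠ 1 := by simpa using hα₂ 1 zero_le_one
  have hne : ∃ n : ℕ, (2 * c₁ * α₁ ^ n + 2 * c₂ * α₂ ^ n).re ≠ 0 :=
    exists_re_add_ne_zero hn₁ hn₂ hα₁_ne_one hα₂_ne_one h₁₂ h₂₁
      (mul_ne_zero two_ne_zero hc₁) (mul_ne_zero two_ne_zero hc₂)
  simpa using exists_frequently_lt_re_sum_mul_pow_and_lt_neg (α := ![α₁, α₂])
    (c := ![2 * c₁, 2 * c₂]) (by simp [Fin.forall_fin_two, hn₁, hn₂])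
    (by simp [Fin.forall_fin_two, hα₁_ne_one, hα₂_ne_one]) (by simpa using hne)
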